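/- Let $A\subseteq\mathbb{Z}$ be a finite set of cardinality $t$, and let $(\xi_\alpha)_{\alpha\in A}$ be independent standard Gaussian random variables ($\xi_\alpha\sim\mathcal N(0,1)$). Consider the random univariate sparse (Laurent) polynomial $$f(x)=\sum_{\alpha\in A}\xi_\alpha\,x^{\alpha},\qquad x>0,$$ and let $N:=\#\{x\in\mathbb{R} : x>0,\ f(x)=0,\ f'(x)\neq 0\}\in\mathbb{N}\cup\{\infty\}$ be the number of its nondegenerate positive zeros. Then $N$ is a random variable (that is, it is measurable up to modification on a null set), and its expectation satisfies $$\mathbb{E}\,N\;\le\;\frac{2}{\pi}\sqrt{t}\,\log t ,$$ where $\log$ is the natural logarithm and, for $t=0$, the right-hand side is read as $0$. -/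

import Mathlib

open scoped ENNReal

namespace SparsePoly

/-- The univariate sparse (Laurent) polynomial function `x ↦ ∑ α ∈ A, σ(α) c(α) x ^ α` with
support `A`, scaling (standard deviations) `σ` and coefficients `c`. -/
noncomputable def eval (A : Finset ℤ) (σ : A → ℝ) (c : A → ℝ) (x : ℝ) : ℝ :=
  ∑ α : A, σ α * c α * x ^ (α : ℤ)

/-- The nondegenerate positive zeros of a function of one real variable. -/
def nondegPosZeros (f : ℝ → ℝ) : Set ℝ :=
  {x | 0 < x ∧ f x = 0 ∧ deriv f x ≠ 0}

/-- The number, in `[0, ∞]`, of nondegenerate positive zeros of the sparse polynomial with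
support `A`, scaling `σ` and coefficients `c`. -/
noncomputable def numZeros (A : Finset ℤ) (σ : A → ℝ) (c : A → ℝ) : ℝ≥0∞ :=
  ((nondegPosZeros (eval A σ c)).encard : ℝ≥0∞)

end SparsePoly

/-!
# Expected number of positive zeros of a Gaussian sparse polynomial

After the substitution `x = exp s` the polynomial becomes an exponential sum
`g(s) = ∑ ξᵢ exp(aᵢ s)` with increasing frequencies `a₀ < a₁ < ⋯`. Up to a positive factor, `g(s)`
is the linear form `⟨u(s), ξ⟩` in a standard Gaussian vector `ξ`, where `u(s)` is the unit vector
in the direction `(exp(aᵢ s))ᵢ`. Hence `g` has different signs at `s` and `s'` with probability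
`∠(u(s), u(s')) / π` (`sign_change_linear_forms_le`, proved in polar coordinates).

The number of nondegenerate zeros is at most the lower limit, as the grid is refined, of the number
of sign changes of `g` along the grid (`encard_nondegZeros_le_liminf`). By Fatou's lemma its
expectation is therefore at most `1 / π` times the length of the curve `u`, approximated by sums of
angles. No Kac–Rice formula is needed.

The length is bounded by the `ℓ¹` length, the sum of the total variations of the coordinates `uᵢ`
(`sum_variation_unitCurve_le`). Since `1 / uᵢ²` is convex, `uᵢ` is unimodal and varies by at most
twice its maximum. With `t` frequencies this maximum is at most `1 / √(min (i + 1) (t - i))`,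
because for `s ≤ 0` the entries with smaller frequency are at least as large as the `i`-th one, and
for `s ≥ 0` those with larger frequency are. The two extreme coordinates are monotone and vary by at
most `1`. The resulting sum is at most `2 √t log t` when `t ≥ 3` (`two_mul_sum_inv_sqrt_le`).

For `t = 2` there is at most one zero, and only if the two coefficients have opposite signs, which
has probability `1 / 2`. For `t ≤ 1` there is none.

Measurability holds because the number of nondegenerate zeros is lower semicontinuous in the
coefficients (`lowerSemicontinuous_encard_nondegZeros`).
-/

namespace SparsePoly

section Deterministic

open Finset Real

/-! ### Variation of unimodal sequences -/

/-- A quasiconcave sequence bounded by `M` rises to at most `M` and then falls. -/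
theorem sum_abs_sub_le_of_quasiconcave (F : ℕ → ℝ) (M : ℝ) (hM : ∀ i, F i ≤ M)
    (hF : ∀ i j k, i ≤ j → j ≤ k → min (F i) (F k) ≤ F j) (n : ℕ) :
    ∑ i ∈ range n, |F (i + 1) - F i| ≤ 2 * M - F 0 - F n := by
  induction n with
  | zero => simp; linarith [hM 0]
  | succ n ih =>
    rcases le_or_gt (F (n + 1)) (F n) with h | h
    · rw [sum_range_succ, abs_of_nonpos (by linarith)]
      linarith
    · have hmono : ∀ i ≤ n, F i ≤ F (i + 1) := by
        intro i hi
        have h1 : F i ≤ F n := by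
          rcases min_le_iff.1 (hF i n (n + 1) hi n.le_succ) with h' | h' <;> linarith
        rcases min_le_iff.1 (hF i (i + 1) (n + 1) i.le_succ (by omega)) with h' | h' <;> linarith
      rw [sum_congr rfl (g := fun i => F (i + 1) - F i), sum_range_sub]
      · linarith [hM (n + 1)]
      · intro i hi
        rw [abs_of_nonneg]
        linarith [hmono i (by simpa [Nat.lt_succ_iff] using hi)]

theorem sum_abs_sub_eq_of_monotone (F : ℕ → ℝ) (hF : Monotone F) (n : ℕ) :
    ∑ i ∈ range n, |F (i + 1) - F i| = F n - F 0 := by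
  rw [← sum_range_sub]
  exact sum_congr rfl fun i _ => abs_of_nonneg (sub_nonneg.2 (hF i.le_succ))

/-- For `i < t` the smaller of `i + 1` and `t - i` runs through `1, 1, 2, 2, 3, 3, …`, as
`i / 2 + 1` does. -/
theorem sum_range_comp_min (t : ℕ) (h : ℕ → ℝ) :
    ∑ i ∈ range t, h (min (i + 1) (t - i)) = ∑ i ∈ range t, h (i / 2 + 1) := by
  induction t using Nat.twoStepInduction generalizing h with
  | zero => simp
  | one => simp
  | more t ih _ =>
    rw [sum_range_succ, sum_range_succ', sum_range_succ', sum_range_succ']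
    have e1 : ∑ i ∈ range t, h (min (i + 1 + 1) (t + 2 - (i + 1)))
        = ∑ i ∈ range t, h (min (i + 1) (t - i) + 1) :=
      sum_congr rfl fun i hi => by
        have := mem_range.1 hi
        congr 1; omega
    have e2 : ∑ i ∈ range t, h ((i + 1 + 1) / 2 + 1) = ∑ i ∈ range t, h (i / 2 + 1 + 1) :=
      sum_congr rfl fun i _ => by congr 1; omega
    rw [e1, e2, ih fun m => h (m + 1)]
    have e3 : min (t + 1 + 1) (t + 2 - (t + 1)) = 1 := by omega
    have e4 : min (0 + 1) (t + 2 - 0) = 1 := by omega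
    rw [e3, e4]

/-- The increments of the left side are at most `2 √2 / √(t + 1)`, those of the right side at least
`(log t + 2) / √(t + 1)`. The claim fails for `t = 2`, where the left side is `2`. -/
theorem two_mul_sum_inv_sqrt_le (t : ℕ) (ht : 3 ≤ t) :
    2 * ∑ i ∈ range t, (√((i / 2 + 1 : ℕ) : ℝ))⁻¹ - 2 ≤ 2 * √(t : ℝ) * log t := by
  have hlog3 : (1 : ℝ) ≤ log 3 := by
    rw [Real.le_log_iff_exp_le (by norm_num)]
    linarith [Real.exp_one_lt_d9]
  have h2lo : (1.414 : ℝ) ≤ √2 := Real.le_sqrt_of_sq_le (by norm_num)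
  have h2hi : √2 ≤ (1.415 : ℝ) := Real.sqrt_le_iff.2 (by norm_num)
  have h3lo : (1.73 : ℝ) ≤ √3 := Real.le_sqrt_of_sq_le (by norm_num)
  induction t, ht using Nat.le_induction with
  | base =>
    simp only [sum_range_succ, sum_range_zero]
    norm_num
    have hs : (√2)⁻¹ = √2 / 2 := by
      rw [inv_eq_one_div, div_eq_div_iff (by positivity) (by norm_num)]
      nlinarith [Real.mul_self_sqrt (show (0 : ℝ) ≤ 2 by norm_num)]
    rw [hs]
    nlinarith
  | succ t ht ih =>
    rw [sum_range_succ]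
    have htR : (3 : ℝ) ≤ t := by exact_mod_cast ht
    have htlog : 1 ≤ log (t : ℝ) := hlog3.trans (Real.log_le_log (by norm_num) htR)
    set p := √(t : ℝ) with hp
    set q := √((t + 1 : ℕ) : ℝ) with hq
    have hp0 : 0 < p := Real.sqrt_pos.2 (by linarith)
    have hq0 : 0 < q := Real.sqrt_pos.2 (by positivity)
    have hpp : p * p = t := Real.mul_self_sqrt (by linarith)
    have hqq : q * q = t + 1 := by
      rw [hq, Real.mul_self_sqrt (by positivity)]; push_cast; ring
    have hpq : p ≤ q := Real.sqrt_le_sqrt (by push_cast; linarith)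
    have hterm : (√((t / 2 + 1 : ℕ) : ℝ))⁻¹ ≤ √2 / q := by
      rw [← one_div, div_le_div_iff₀ (by positivity) hq0, one_mul, hq,
        ← Real.sqrt_mul (by norm_num)]
      apply Real.sqrt_le_sqrt
      have : t + 1 ≤ 2 * (t / 2 + 1) := by omega
      exact_mod_cast this
    -- `log (t + 1) - log t ≥ 1 / (t + 1)` and `√(t + 1) - √t ≥ 1 / (2 √(t + 1))`
    have hlogd : 1 / (q * q) ≤ log ((t + 1 : ℕ) : ℝ) - log t := by
      have h := Real.log_le_sub_one_of_pos (show 0 < (t : ℝ) / (t + 1) by positivity)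
      rw [Real.log_div (by positivity) (by positivity)] at h
      have e : (t : ℝ) / (t + 1) - 1 = - (1 / (q * q)) := by
        rw [hqq]; field_simp; ring
      push_cast
      linarith
    have hsq : 1 / (2 * q) ≤ q - p := by
      rw [div_le_iff₀ (by positivity)]
      nlinarith
    have hA : q * (1 / (q * q)) ≤ q * (log ((t + 1 : ℕ) : ℝ) - log t) :=
      mul_le_mul_of_nonneg_left hlogd hq0.le
    have hB : 1 / (2 * q) * 1 ≤ (q - p) * log t :=
      mul_le_mul hsq htlog (by norm_num) (by linarith)
    have e1 : q * (1 / (q * q)) = 1 / q := by field_simp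
    have e2 : 1 / (2 * q) * 1 = (1 / q) / 2 := by field_simp
    have e3 : √2 / q = √2 * (1 / q) := by ring
    rw [e1] at hA
    rw [e2] at hB
    rw [e3] at hterm
    have hq1 : 0 < 1 / q := by positivity
    nlinarith

/-! ### The unit curve of an exponential sum -/

/-- The angle between two unit vectors at an acute angle exceeds their `ℓ¹` distance by at most
the factor `1 / ρ`, where `ρ` is their inner product. -/
theorem arccos_mul_le_sum_abs_sub {ι : Type*} [Fintype ι] (u w : ι → ℝ)
    (hu : ∑ i, u i ^ 2 = 1) (hw : ∑ i, w i ^ 2 = 1) (h0 : 0 < ∑ i, u i * w i) :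
    arccos (∑ i, u i * w i) * ∑ i, u i * w i ≤ ∑ i, |w i - u i| := by
  set ρ := ∑ i, u i * w i with hρ
  set L := ∑ i, |w i - u i| with hL
  have hL0 : 0 ≤ L := sum_nonneg fun i _ => abs_nonneg _
  have hsq : ∑ i, (w i - u i) ^ 2 = 2 - 2 * ρ := by
    have : ∀ i, (w i - u i) ^ 2 = w i ^ 2 + u i ^ 2 - 2 * (u i * w i) := fun i => by ring
    simp_rw [this, sum_sub_distrib, sum_add_distrib, ← mul_sum, hu, hw]
    ring
  have hρ1 : ρ ≤ 1 := by
    have : 0 ≤ ∑ i, (w i - u i) ^ 2 := sum_nonneg fun i _ => sq_nonneg _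
    linarith
  have hchord : ∑ i, (w i - u i) ^ 2 ≤ L ^ 2 := by
    have := sum_sq_le_sq_sum_of_nonneg (s := univ) (f := fun i => |w i - u i|)
      fun i _ => abs_nonneg _
    simpa [sq_abs] using this
  set θ := arccos ρ with hθ
  have hcos : cos θ = ρ := Real.cos_arccos (by linarith) hρ1
  have hθ0 : 0 ≤ θ := Real.arccos_nonneg _
  have hθπ : θ < π / 2 := Real.arccos_lt_pi_div_two.2 h0
  have hhalf : cos θ = 1 - 2 * sin (θ / 2) ^ 2 := by
    have := Real.cos_two_mul (θ / 2)
    rw [mul_div_cancel₀ θ two_ne_zero] at this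
    have := Real.sin_sq_add_cos_sq (θ / 2)
    linarith
  have hsin : 2 * sin (θ / 2) ≤ L := by
    apply le_of_sq_le_sq _ hL0
    nlinarith
  have hc : cos θ ≤ cos (θ / 2) :=
    Real.cos_le_cos_of_nonneg_of_le_pi (by linarith) (by linarith) (by linarith)
  have htan : θ / 2 ≤ tan (θ / 2) := Real.le_tan (by linarith) (by linarith)
  rw [Real.tan_eq_sin_div_cos, le_div_iff₀ (by linarith)] at htan
  nlinarith

/-- The exponential sum `s ↦ ∑ i, c i * exp (a i * s)` with frequencies `a` and
coefficients `c`. -/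
noncomputable def expSum {ι : Type*} [Fintype ι] (a c : ι → ℝ) (s : ℝ) : ℝ :=
  ∑ i, c i * exp (a i * s)

/-- The normalization of the curve `s ↦ (exp (a i * s))ᵢ` to Euclidean norm one. The norm is
absorbed into the exponents, which makes the reciprocal of each squared coordinate visibly convex;
see `unitCurve_mul_norm` for the usual form. -/
noncomputable def unitCurve {ι : Type*} [Fintype ι] (a : ι → ℝ) (s : ℝ) (i : ι) : ℝ :=
  (√(∑ k, exp (2 * (a k - a i) * s)))⁻¹

section unitCurve

variable {ι : Type*} [Fintype ι] (a : ι → ℝ)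

theorem one_le_sum_exp (s : ℝ) (i : ι) : 1 ≤ ∑ k, exp (2 * (a k - a i) * s) := by
  have := single_le_sum (f := fun k => exp (2 * (a k - a i) * s)) (fun k _ => (exp_pos _).le)
    (mem_univ i)
  simpa using this

theorem unitCurve_nonneg (s : ℝ) (i : ι) : 0 ≤ unitCurve a s i :=
  inv_nonneg.2 (Real.sqrt_nonneg _)

theorem unitCurve_le_inv_sqrt (s : ℝ) (i : ι) {m : ℕ} (hm : 0 < m)
    (h : (m : ℝ) ≤ ∑ k, exp (2 * (a k - a i) * s)) : unitCurve a s i ≤ (√(m : ℝ))⁻¹ :=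
  inv_anti₀ (Real.sqrt_pos.2 (by exact_mod_cast hm)) (Real.sqrt_le_sqrt h)

theorem unitCurve_le_one (s : ℝ) (i : ι) : unitCurve a s i ≤ 1 := by
  simpa using unitCurve_le_inv_sqrt a s i one_pos (by simpa using one_le_sum_exp a s i)

theorem unitCurve_mul_norm (s : ℝ) (i : ι) :
    unitCurve a s i * √(∑ k, exp (2 * a k * s)) = exp (a i * s) := by
  have h : ∑ k, exp (2 * a k * s) = exp (a i * s) ^ 2 * ∑ k, exp (2 * (a k - a i) * s) := by
    rw [mul_sum]
    refine sum_congr rfl fun k _ => ?_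
    rw [← Real.exp_nat_mul, ← Real.exp_add]
    congr 1; push_cast; ring
  have h1 := one_le_sum_exp a s i
  rw [h, Real.sqrt_mul (by positivity), Real.sqrt_sq (exp_pos _).le, unitCurve]
  have : √(∑ k, exp (2 * (a k - a i) * s)) ≠ 0 := (Real.sqrt_pos.2 (by linarith)).ne'
  rw [mul_left_comm, inv_mul_cancel₀ this, mul_one]

theorem sqrt_sum_exp_pos [Nonempty ι] (s : ℝ) : 0 < √(∑ k, exp (2 * a k * s)) :=
  Real.sqrt_pos.2 (sum_pos (fun _ _ => exp_pos _) univ_nonempty)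

theorem sum_unitCurve_sq [Nonempty ι] (s : ℝ) : ∑ i, unitCurve a s i ^ 2 = 1 := by
  have h := sqrt_sum_exp_pos a s
  have h2 : ∑ i, unitCurve a s i ^ 2 * (√(∑ k, exp (2 * a k * s))) ^ 2
      = (√(∑ k, exp (2 * a k * s))) ^ 2 := by
    simp_rw [← mul_pow, unitCurve_mul_norm]
    rw [Real.sq_sqrt (by positivity)]
    refine sum_congr rfl fun k _ => ?_
    rw [← Real.exp_nat_mul]
    congr 1; push_cast; ring
  rw [← sum_mul] at h2
  exact (mul_eq_right₀ (by positivity)).1 h2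

theorem expSum_eq_norm_mul (c : ι → ℝ) (s : ℝ) :
    expSum a c s = √(∑ k, exp (2 * a k * s)) * ∑ i, unitCurve a s i * c i := by
  rw [expSum, mul_sum]
  refine sum_congr rfl fun i _ => ?_
  rw [← unitCurve_mul_norm a s i]
  ring

/-- Each squared coordinate of the unit curve is the reciprocal of a convex function, so each
coordinate increases up to some point and decreases from there on. -/
theorem unitCurve_quasiconcave (i : ι) {x y z : ℝ} (hxy : x ≤ y) (hyz : y ≤ z) :
    min (unitCurve a x i) (unitCurve a z i) ≤ unitCurve a y i := by
  have hconv : ConvexOn ℝ Set.univ fun s => ∑ k, exp (2 * (a k - a i) * s) := by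
    refine ⟨convex_univ, fun x _ y _ p q hp hq hpq => ?_⟩
    rw [smul_sum, smul_sum, ← sum_add_distrib]
    refine sum_le_sum fun k _ => ?_
    have h := convexOn_exp.2 (Set.mem_univ (2 * (a k - a i) * x))
      (Set.mem_univ (2 * (a k - a i) * y)) hp hq hpq
    have e : 2 * (a k - a i) * (p • x + q • y)
        = p • (2 * (a k - a i) * x) + q • (2 * (a k - a i) * y) := by
      simp only [smul_eq_mul]; ring
    rw [e]
    exact h
  have h := hconv.le_max_of_mem_Icc (Set.mem_univ x) (Set.mem_univ z) ⟨hxy, hyz⟩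
  have hy : 0 < √(∑ k, exp (2 * (a k - a i) * y)) :=
    Real.sqrt_pos.2 (by linarith [one_le_sum_exp a y i])
  rcases le_max_iff.1 h with h | h
  · exact (min_le_left _ _).trans (inv_anti₀ hy (Real.sqrt_le_sqrt h))
  · exact (min_le_right _ _).trans (inv_anti₀ hy (Real.sqrt_le_sqrt h))

theorem unitCurve_monotone (i : ι) (hi : ∀ k, a k ≤ a i) :
    Monotone fun s => unitCurve a s i := by
  intro x y hxy
  refine inv_anti₀ (Real.sqrt_pos.2 (by linarith [one_le_sum_exp a y i])) (Real.sqrt_le_sqrt ?_)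
  refine sum_le_sum fun k _ => Real.exp_le_exp.2 ?_
  nlinarith [hi k]

theorem unitCurve_neg (s : ℝ) (i : ι) : unitCurve (fun k => -a k) (-s) i = unitCurve a s i := by
  unfold unitCurve
  congr 3 with k
  congr 1; ring

theorem unitCurve_antitone (i : ι) (hi : ∀ k, a i ≤ a k) :
    Antitone fun s => unitCurve a s i := by
  intro x y hxy
  have := unitCurve_monotone (fun k => -a k) i (fun k => neg_le_neg (hi k)) (neg_le_neg hxy)
  simpa only [unitCurve_neg] using this

/-- Nearby points of the unit curve are nearly parallel, uniformly along the curve. -/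
theorem exp_le_inner_unitCurve [Nonempty ι] {D : ℝ} (hD : ∀ i, |a i| ≤ D) {s s' : ℝ}
    (hs : s ≤ s') : exp (-(2 * D * (s' - s))) ≤ ∑ i, unitCurve a s i * unitCurve a s' i := by
  have hb : ∀ k, |a k * (s' - s)| ≤ D * (s' - s) := fun k => by
    rw [abs_mul, abs_of_nonneg (sub_nonneg.2 hs)]
    exact mul_le_mul_of_nonneg_right (hD k) (sub_nonneg.2 hs)
  have h : ∀ i, exp (-(2 * D * (s' - s))) * unitCurve a s i ≤ unitCurve a s' i := by
    intro i
    unfold unitCurve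
    have hp : 0 < √(∑ k, exp (2 * (a k - a i) * s)) :=
      Real.sqrt_pos.2 (by linarith [one_le_sum_exp a s i])
    have hp' : 0 < √(∑ k, exp (2 * (a k - a i) * s')) :=
      Real.sqrt_pos.2 (by linarith [one_le_sum_exp a s' i])
    rw [← div_eq_mul_inv, ← one_div, div_le_div_iff₀ hp hp', one_mul]
    have e : exp (-(2 * D * (s' - s))) = √(exp (-(2 * D * (s' - s))) ^ 2) :=
      (Real.sqrt_sq (exp_pos _).le).symm
    rw [e, ← Real.sqrt_mul (by positivity)]
    apply Real.sqrt_le_sqrt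
    rw [mul_sum]
    refine sum_le_sum fun k _ => ?_
    rw [← Real.exp_nat_mul, ← Real.exp_add]
    refine Real.exp_le_exp.2 ?_
    push_cast
    have h1 := abs_le.1 (hb k)
    have h2 := abs_le.1 (hb i)
    nlinarith
  calc exp (-(2 * D * (s' - s)))
      = ∑ i, unitCurve a s i * (exp (-(2 * D * (s' - s))) * unitCurve a s i) := by
        have : ∀ i, unitCurve a s i * (exp (-(2 * D * (s' - s))) * unitCurve a s i)
          = exp (-(2 * D * (s' - s))) * unitCurve a s i ^ 2 := fun i => by ring
        simp_rw [this, ← mul_sum, sum_unitCurve_sq, mul_one]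
    _ ≤ _ := sum_le_sum fun i _ => mul_le_mul_of_nonneg_left (h i) (unitCurve_nonneg a s i)

end unitCurve

/-- At `s ≤ 0` the exponentials with smaller frequency dominate the `i`-th one, and at `s ≥ 0` those
with larger frequency do; this bounds the `i`-th coordinate of a unit vector. -/
theorem unitCurve_le_inv_sqrt_min {t : ℕ} (a : Fin t → ℝ) (ha : Monotone a) (s : ℝ) (i : Fin t) :
    unitCurve a s i ≤ (√((min (i + 1) (t - i) : ℕ) : ℝ))⁻¹ := by
  have hi := i.2
  apply unitCurve_le_inv_sqrt a s i (by omega)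
  have key : ∀ S : Finset (Fin t), (∀ k ∈ S, 0 ≤ (a k - a i) * s) →
      (#S : ℝ) ≤ ∑ k, exp (2 * (a k - a i) * s) := by
    intro S hS
    calc (#S : ℝ) = ∑ k ∈ S, (1 : ℝ) := by simp
      _ ≤ ∑ k ∈ S, exp (2 * (a k - a i) * s) :=
        sum_le_sum fun k hk => Real.one_le_exp (by nlinarith [hS k hk])
      _ ≤ _ := sum_le_sum_of_subset_of_nonneg (subset_univ _) fun _ _ _ => (exp_pos _).le
  rcases le_total s 0 with hs | hs
  · refine le_trans ?_ (key (Iic i) fun k hk => ?_)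
    · rw [Fin.card_Iic]; exact_mod_cast min_le_left _ _
    · have := ha (mem_Iic.1 hk)
      nlinarith
  · refine le_trans ?_ (key (Ici i) fun k hk => ?_)
    · rw [Fin.card_Ici]; exact_mod_cast min_le_right _ _
    · have := ha (mem_Ici.1 hk)
      nlinarith

/-- The `ℓ¹` length of the unit curve: each coordinate contributes at most twice its maximum, and
the two extreme coordinates, being monotone, at most `1`. -/
theorem sum_variation_unitCurve_le {t : ℕ} (ht : 3 ≤ t) (a : Fin t → ℝ) (ha : Monotone a)
    (σ : ℕ → ℝ) (hσ : Monotone σ) (n : ℕ) :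
    ∑ k ∈ range n, ∑ i, |unitCurve a (σ (k + 1)) i - unitCurve a (σ k) i|
      ≤ 2 * √(t : ℝ) * log t := by
  obtain ⟨t, rfl⟩ : ∃ m, t = m + 2 := ⟨t - 2, by omega⟩
  rw [sum_comm]
  set h : ℕ → ℝ := fun m => (√(m : ℝ))⁻¹ with hh
  set V : Fin (t + 2) → ℝ :=
    fun i => ∑ k ∈ range n, |unitCurve a (σ (k + 1)) i - unitCurve a (σ k) i| with hV
  have hmid : ∀ i, V i ≤ 2 * h (min (i + 1) (t + 2 - i)) := by
    intro i
    have := sum_abs_sub_le_of_quasiconcave (fun k => unitCurve a (σ k) i)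
      (h (min (i + 1) (t + 2 - i))) (fun k => unitCurve_le_inv_sqrt_min a ha _ i)
      (fun x y z hxy hyz => unitCurve_quasiconcave a i (hσ hxy) (hσ hyz)) n
    have h0 := unitCurve_nonneg a (σ 0) i
    have hn := unitCurve_nonneg a (σ n) i
    simp only [hV]
    linarith
  have hlast : V (Fin.last _) ≤ 1 := by
    have := sum_abs_sub_eq_of_monotone (fun k => unitCurve a (σ k) (Fin.last _))
      ((unitCurve_monotone a _ fun k => ha (Fin.le_last k)).comp hσ) n
    simp only [hV]
    rw [this]
    linarith [unitCurve_nonneg a (σ 0) (Fin.last _), unitCurve_le_one a (σ n) (Fin.last _)]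
  have hzero : V 0 ≤ 1 := by
    have := sum_abs_sub_eq_of_monotone (fun k => -unitCurve a (σ k) 0)
      ((unitCurve_antitone a 0 fun k => ha (Fin.zero_le k)).neg.comp hσ) n
    have e : V 0 = ∑ i ∈ range n, |-unitCurve a (σ (i + 1)) 0 - -unitCurve a (σ i) 0| :=
      sum_congr rfl fun i _ => by rw [abs_sub_comm]; congr 1; ring
    rw [e, this]
    linarith [unitCurve_nonneg a (σ n) 0, unitCurve_le_one a (σ 0) 0]
  refine le_trans ?_ (two_mul_sum_inv_sqrt_le (t + 2) ht)
  have hsum := sum_range_comp_min (t + 2) h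
  rw [← Fin.sum_univ_eq_sum_range (fun i => h (min (i + 1) (t + 2 - i)))] at hsum
  change ∑ i, V i ≤ 2 * ∑ i ∈ range (t + 2), h (i / 2 + 1) - 2
  rw [← hsum, Fin.sum_univ_succ, Fin.sum_univ_castSucc, Fin.sum_univ_succ, Fin.sum_univ_castSucc,
    ← Fin.succ_last] at *
  have hm := sum_le_sum fun (i : Fin t) (_ : i ∈ univ) => hmid i.castSucc.succ
  rw [← mul_sum] at hm
  have e0 : h (min (((0 : Fin (t + 2)) : ℕ) + 1) (t + 2 - ((0 : Fin (t + 2)) : ℕ))) = 1 := by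
    simp [hh]
  have e1 : h (min (((Fin.last t).succ : ℕ) + 1) (t + 2 - ((Fin.last t).succ : ℕ))) = 1 := by
    simp [hh]
  rw [e0, e1]
  linarith

end Deterministic

/-! ### Sign changes of Gaussian pairs -/

section Gaussian

open MeasureTheory ProbabilityTheory Real Set

/-- The standard Gaussian measure of a planar cone is proportional to its opening: the law is a
product in polar coordinates, and the radial factor is determined by the total mass. -/
theorem two_pi_mul_gaussian_prod_cone {E : Set (ℝ × ℝ)} (hE : MeasurableSet E) {G : Set ℝ}
    (hG : MeasurableSet G)
    (hEG : ∀ r φ : ℝ, 0 < r → ((r * cos φ, r * sin φ) ∈ E ↔ φ ∈ G)) :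
    ENNReal.ofReal (2 * π) * ((gaussianReal 0 1).prod (gaussianReal 0 1)) E
      = volume (G ∩ Ioo (-π) π) := by
  set R : ℝ≥0∞ := ∫⁻ r in Ioi (0 : ℝ),
    ENNReal.ofReal r * ENNReal.ofReal ((2 * π)⁻¹ * exp (-r ^ 2 / 2)) with hR
  have key : ∀ {E : Set (ℝ × ℝ)} {G : Set ℝ}, MeasurableSet E → MeasurableSet G →
      (∀ r φ : ℝ, 0 < r → ((r * cos φ, r * sin φ) ∈ E ↔ φ ∈ G)) →
      ((gaussianReal 0 1).prod (gaussianReal 0 1)) E = R * volume (G ∩ Ioo (-π) π) := by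
    intro E G hE hG hEG
    have hdens : (gaussianReal 0 1).prod (gaussianReal 0 1)
        = (volume : Measure (ℝ × ℝ)).withDensity
          fun z => ENNReal.ofReal ((2 * π)⁻¹ * exp (-(z.1 ^ 2 + z.2 ^ 2) / 2)) := by
      rw [gaussianReal_of_var_ne_zero _ one_ne_zero,
        prod_withDensity (measurable_gaussianPDF _ _) (measurable_gaussianPDF _ _),
        ← Measure.volume_eq_prod]
      congr 1
      ext z
      rw [gaussianPDF, gaussianPDF, ← ENNReal.ofReal_mul (gaussianPDFReal_nonneg _ _ _)]
      congr 1
      simp only [gaussianPDFReal, NNReal.coe_one, mul_one, sub_zero]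
      rw [mul_mul_mul_comm, ← Real.exp_add, ← mul_inv, Real.mul_self_sqrt (by positivity)]
      congr 2
      ring
    rw [hdens, withDensity_apply _ hE, ← lintegral_indicator hE,
      ← lintegral_comp_polarCoord_symm, polarCoord_target,
      setLIntegral_congr_fun (g := fun p : ℝ × ℝ =>
        (ENNReal.ofReal p.1 * ENNReal.ofReal ((2 * π)⁻¹ * exp (-p.1 ^ 2 / 2)))
          * G.indicator 1 p.2) (measurableSet_Ioi.prod measurableSet_Ioo),
      Measure.volume_eq_prod, ← Measure.prod_restrict,
      lintegral_prod_mul (f := fun r : ℝ =>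
        ENNReal.ofReal r * ENNReal.ofReal ((2 * π)⁻¹ * exp (-r ^ 2 / 2)))
        (g := G.indicator 1) (by fun_prop) (by fun_prop (disch := assumption)),
      lintegral_indicator_one hG, Measure.restrict_apply hG]
    rintro ⟨r, φ⟩ ⟨hr, -⟩
    have hr : 0 < r := hr
    simp only [polarCoord_symm_apply, smul_eq_mul]
    by_cases hφ : φ ∈ G
    · rw [indicator_of_mem hφ, indicator_of_mem ((hEG r φ hr).2 hφ)]
      simp only [Pi.one_apply, mul_one]
      congr 4
      linear_combination (-r ^ 2 / 2) * Real.sin_sq_add_cos_sq φ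
    · rw [indicator_of_notMem hφ, indicator_of_notMem (fun h => hφ ((hEG r φ hr).1 h))]
      simp
  have htot := key MeasurableSet.univ MeasurableSet.univ (fun _ _ _ => by simp)
  rw [measure_univ, univ_inter, Real.volume_Ioo, sub_neg_eq_add, ← two_mul] at htot
  rw [key hE hG hEG, ← mul_assoc, mul_comm _ R, ← htot, one_mul]

/-- For independent standard Gaussians `X`, `Y`, the signs of `X` and `X cos θ + Y sin θ` differ
with probability at most `θ / π`. -/
theorem gaussian_prod_sign_change_le {θ : ℝ} (h0 : 0 ≤ θ) (h1 : θ ≤ π / 2) :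
    ((gaussianReal 0 1).prod (gaussianReal 0 1))
      {p : ℝ × ℝ | p.1 * (cos θ * p.1 + sin θ * p.2) ≤ 0} ≤ ENNReal.ofReal (θ / π) := by
  have hpi := Real.pi_pos
  have h := two_pi_mul_gaussian_prod_cone
    (E := {p : ℝ × ℝ | p.1 * (cos θ * p.1 + sin θ * p.2) ≤ 0})
    (G := {φ : ℝ | cos φ * cos (φ - θ) ≤ 0})
    (measurableSet_le (by fun_prop) (by fun_prop)) (measurableSet_le (by fun_prop) (by fun_prop))
    (fun r φ hr => by
      simp only [mem_ofPred_eq]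
      have e : r * cos φ * (cos θ * (r * cos φ) + sin θ * (r * sin φ))
          = r ^ 2 * (cos φ * cos (φ - θ)) := by rw [Real.cos_sub]; ring
      rw [e]
      have : 0 < r ^ 2 := by positivity
      constructor
      · intro h
        by_contra! hc
        nlinarith
      · intro h
        exact mul_nonpos_of_nonneg_of_nonpos this.le h)
  have hsub : {φ : ℝ | cos φ * cos (φ - θ) ≤ 0} ∩ Ioo (-π) π
      ⊆ Icc (π / 2) (π / 2 + θ) ∪ Icc (-(π / 2)) (θ - π / 2) := by
    rintro φ ⟨hφ, hl, hr⟩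
    simp only [mem_ofPred_eq] at hφ
    by_contra hc
    simp only [mem_union, mem_Icc, not_or, not_and, not_le] at hc
    refine absurd hφ (not_le.2 ?_)
    rcases lt_or_ge φ (-(π / 2)) with h3 | h3
    · apply mul_pos_of_neg_of_neg
      · rw [← Real.cos_neg]
        exact Real.cos_neg_of_pi_div_two_lt_of_lt (by linarith) (by linarith)
      · rw [← Real.cos_neg]
        exact Real.cos_neg_of_pi_div_two_lt_of_lt (by linarith) (by linarith)
    · have h4 := hc.2 h3
      rcases lt_or_ge φ (π / 2) with h5 | h5
      · by_cases h6 : φ = -(π / 2)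
        · linarith
        exact mul_pos (Real.cos_pos_of_mem_Ioo ⟨lt_of_le_of_ne h3 (Ne.symm h6), h5⟩)
          (Real.cos_pos_of_mem_Ioo ⟨by linarith, by linarith⟩)
      · have h6 := hc.1 h5
        apply mul_pos_of_neg_of_neg
        · exact Real.cos_neg_of_pi_div_two_lt_of_lt (by linarith) (by linarith)
        · exact Real.cos_neg_of_pi_div_two_lt_of_lt (by linarith) (by linarith)
  have hvol : volume ({φ : ℝ | cos φ * cos (φ - θ) ≤ 0} ∩ Ioo (-π) π)
      ≤ ENNReal.ofReal (2 * θ) := by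
    refine (measure_mono hsub).trans ((measure_union_le _ _).trans ?_)
    rw [Real.volume_Icc, Real.volume_Icc, ← ENNReal.ofReal_add (by linarith) (by linarith)]
    exact ENNReal.ofReal_le_ofReal (by linarith)
  rw [← h] at hvol
  have e : ENNReal.ofReal (2 * θ) = ENNReal.ofReal (2 * π) * ENNReal.ofReal (θ / π) := by
    rw [← ENNReal.ofReal_mul (by positivity)]
    congr 1; field_simp
  rw [e] at hvol
  exact (ENNReal.mul_le_mul_iff_right (by simpa using hpi) ENNReal.ofReal_ne_top).1 hvol

variable {Ω : Type*} [MeasurableSpace Ω] {P : Measure Ω} [IsProbabilityMeasure P]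

/-- Two random variables `X` and `ρ X + Z`, with `X` and `Z` independent and Gaussian of variances
`1` and `1 - ρ ^ 2`, have different signs with probability at most `arccos ρ / π`. -/
theorem sign_change_le_of_indepFun {X Z : Ω → ℝ} {ρ : ℝ} (h0 : 0 ≤ ρ) (h1 : ρ ≤ 1)
    (hX : HasLaw X (gaussianReal 0 1) P)
    (hZ : HasLaw Z (gaussianReal 0 (1 - ρ ^ 2).toNNReal) P) (hXZ : IndepFun X Z P) :
    P {ω | X ω * (ρ * X ω + Z ω) ≤ 0} ≤ ENNReal.ofReal (arccos ρ / π) := by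
  set θ := arccos ρ with hθ
  have hcos : cos θ = ρ := Real.cos_arccos (by linarith) h1
  have hsin : sin θ ^ 2 = 1 - ρ ^ 2 := by rw [← hcos, Real.sin_sq]
  have hjoint : P.map (fun ω => (X ω, Z ω))
      = ((gaussianReal 0 1).prod (gaussianReal 0 1)).map (Prod.map id (sin θ * ·)) := by
    rw [(indepFun_iff_map_prod_eq_prod_map_map hX.aemeasurable hZ.aemeasurable).1 hXZ, hX.map_eq,
      hZ.map_eq, ← Measure.map_prod_map _ _ measurable_id (by fun_prop),
      gaussianReal_map_const_mul, Measure.map_id]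
    congr 2
    · simp
    · rw [mul_one]
      apply NNReal.coe_injective
      rw [Real.coe_toNNReal _ (by rw [← hsin]; positivity), ← hsin]
      rfl
  have hS : MeasurableSet {p : ℝ × ℝ | p.1 * (ρ * p.1 + p.2) ≤ 0} :=
    measurableSet_le (by fun_prop) (by fun_prop)
  have e : P {ω | X ω * (ρ * X ω + Z ω) ≤ 0}
      = P.map (fun ω => (X ω, Z ω)) {p : ℝ × ℝ | p.1 * (ρ * p.1 + p.2) ≤ 0} := by
    rw [Measure.map_apply_of_aemeasurable (hX.aemeasurable.prodMk hZ.aemeasurable) hS]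
    rfl
  rw [e, hjoint, Measure.map_apply (by fun_prop) hS]
  have := gaussian_prod_sign_change_le (Real.arccos_nonneg ρ) (Real.arccos_le_pi_div_two.2 h0)
  rw [← hθ, hcos] at this
  exact this

/-- Two linear forms with unit coefficient vectors at an acute angle, evaluated at a standard
Gaussian vector, have different signs with probability at most that angle divided by `π`. -/
theorem sign_change_linear_forms_le {ι : Type*} [Fintype ι] {ξ : ι → Ω → ℝ}
    (hlaw : ∀ i, HasLaw (ξ i) (gaussianReal 0 1) P) (hindep : iIndepFun ξ P) (u w : ι → ℝ)
    (hu : ∑ i, u i ^ 2 = 1) (hw : ∑ i, w i ^ 2 = 1) (h0 : 0 ≤ ∑ i, u i * w i) :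
    P {ω | (∑ i, u i * ξ i ω) * (∑ i, w i * ξ i ω) ≤ 0}
      ≤ ENNReal.ofReal (arccos (∑ i, u i * w i) / π) := by
  classical
  set ρ := ∑ i, u i * w i with hρ
  have hρ1 : ρ ≤ 1 := by
    have : 0 ≤ ∑ i, (w i - u i) ^ 2 := Finset.sum_nonneg fun i _ => sq_nonneg _
    have e : ∀ i, (w i - u i) ^ 2 = w i ^ 2 + u i ^ 2 - 2 * (u i * w i) := fun i => by ring
    simp_rw [e, Finset.sum_sub_distrib, Finset.sum_add_distrib, ← Finset.mul_sum, hu, hw] at this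
    linarith
  have hG : ∀ i, HasGaussianLaw (ξ i) P := fun i => (hlaw i).hasGaussianLaw
  have hjoint : HasGaussianLaw (fun ω i => ξ i ω) P := hindep.hasGaussianLaw hG
  have hL2 : ∀ i, MemLp (ξ i) 2 P := fun i => (hG i).memLp_two
  have hvar : ∀ i, cov[ξ i, ξ i; P] = 1 := fun i => by
    rw [covariance_self (hlaw i).aemeasurable, (hlaw i).variance_eq, variance_id_gaussianReal]
    rfl
  have hmean : ∀ i, P[ξ i] = 0 := fun i => by
    rw [(hlaw i).integral_eq]; exact integral_id_gaussianReal
  -- covariances of linear forms are inner products of the coefficient vectors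
  have hcov : ∀ p q : ι → ℝ, cov[fun ω => ∑ i, p i * ξ i ω, fun ω => ∑ i, q i * ξ i ω; P]
      = ∑ i, p i * q i := by
    intro p q
    rw [covariance_fun_sum_fun_sum (fun i => (hL2 i).const_mul _) fun i => (hL2 i).const_mul _]
    refine Finset.sum_congr rfl fun i _ => ?_
    rw [Finset.sum_eq_single i]
    · rw [covariance_const_mul_left, covariance_const_mul_right, hvar, mul_one]
    · intro j _ hji
      rw [covariance_const_mul_left, covariance_const_mul_right,
        (hindep.indepFun hji.symm).covariance_eq_zero (hL2 i) (hL2 j)]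
      simp
    · simp
  have hlin : ∀ p : ι → ℝ, HasLaw (fun ω => ∑ i, p i * ξ i ω)
      (gaussianReal 0 (∑ i, p i ^ 2).toNNReal) P := by
    intro p
    have hGp : HasGaussianLaw (fun ω => ∑ i, p i * ξ i ω) P := by
      have := hjoint.map_fun (∑ i, p i • ContinuousLinearMap.proj (R := ℝ) (φ := fun _ : ι => ℝ) i)
      simpa using this
    refine ⟨hGp.aemeasurable, ?_⟩
    rw [hGp.map_eq_gaussianReal, ← covariance_self hGp.aemeasurable, hcov]
    congr 1
    · rw [integral_finsetSum _ fun i _ => (hL2 i).integrable (by norm_num) |>.const_mul _]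
      simp [integral_const_mul, hmean]
    · simp [sq]
  set v : ι → ℝ := fun i => w i - ρ * u i with hv
  have hvsq : ∑ i, v i ^ 2 = 1 - ρ ^ 2 := by
    have e : ∀ i, v i ^ 2 = w i ^ 2 - 2 * ρ * (u i * w i) + ρ ^ 2 * u i ^ 2 := fun i => by
      simp only [hv]; ring
    simp_rw [e, Finset.sum_add_distrib, Finset.sum_sub_distrib, ← Finset.mul_sum, hu, hw, ← hρ]
    ring
  have huv : ∑ i, u i * v i = 0 := by
    have e : ∀ i, u i * v i = u i * w i - ρ * u i ^ 2 := fun i => by simp only [hv]; ring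
    simp_rw [e, Finset.sum_sub_distrib, ← Finset.mul_sum, hu, ← hρ]
    ring
  have hX := hlin u
  rw [hu, Real.toNNReal_one] at hX
  have hZ := hlin v
  rw [hvsq] at hZ
  have hXZ : IndepFun (fun ω => ∑ i, u i * ξ i ω) (fun ω => ∑ i, v i * ξ i ω) P := by
    refine HasGaussianLaw.indepFun_of_covariance_eq_zero ?_ ((hcov u v).trans huv)
    have := hjoint.map_fun
      ((∑ i, u i • ContinuousLinearMap.proj (R := ℝ) (φ := fun _ : ι => ℝ) i).prod
        (∑ i, v i • ContinuousLinearMap.proj (R := ℝ) (φ := fun _ : ι => ℝ) i))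
    simpa using this
  have hY : ∀ ω, ∑ i, w i * ξ i ω = ρ * ∑ i, u i * ξ i ω + ∑ i, v i * ξ i ω := by
    intro ω
    rw [Finset.mul_sum, ← Finset.sum_add_distrib]
    exact Finset.sum_congr rfl fun i _ => by simp only [hv]; ring
  simp_rw [hY]
  exact sign_change_le_of_indepFun h0 hρ1 hX hZ hXZ

end Gaussian

/-! ### Nondegenerate zeros and their stability -/

section Zeros

open Filter Topology Set

/-- The nondegenerate zeros of a function on the whole real line. -/
def nondegZeros (g : ℝ → ℝ) : Set ℝ :=
  {s | g s = 0 ∧ deriv g s ≠ 0}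

/-- A nondegenerate zero separates points of opposite sign. -/
theorem exists_nhds_mul_nonpos {g : ℝ → ℝ} {s : ℝ} (hs : s ∈ nondegZeros g) :
    ∃ V ∈ 𝓝 s, ∀ x ∈ V, ∀ y ∈ V, x ≤ s → s ≤ y →
      g x * g y ≤ 0 ∧ (x < s → s < y → g x * g y < 0) := by
  obtain ⟨h0, h1⟩ := hs
  have key : ∀ h : ℝ → ℝ, h s = 0 → 0 < deriv h s →
      ∃ V ∈ 𝓝 s, ∀ x ∈ V, ∀ y ∈ V, x ≤ s → s ≤ y →
        h x * h y ≤ 0 ∧ (x < s → s < y → h x * h y < 0) := by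
    intro h h0 h1
    refine ⟨_, eventually_nhdsWithin_sign_eq_of_deriv_pos h1 h0, fun x hx y hy hxs hsy => ?_⟩
    have hlt : x < s → h x < 0 := by
      intro hxs
      have hx : SignType.sign (h x) = SignType.sign (x - s) := hx
      rwa [sign_neg (sub_neg.2 hxs), sign_eq_neg_one_iff] at hx
    have hgt : s < y → 0 < h y := by
      intro hsy
      have hy : SignType.sign (h y) = SignType.sign (y - s) := hy
      rwa [sign_pos (sub_pos.2 hsy), sign_eq_one_iff] at hy
    refine ⟨?_, fun h2 h3 => mul_neg_of_neg_of_pos (hlt h2) (hgt h3)⟩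
    rcases hxs.lt_or_eq with h2 | rfl
    · rcases hsy.lt_or_eq with h3 | rfl
      · exact (mul_neg_of_neg_of_pos (hlt h2) (hgt h3)).le
      · rw [h0, mul_zero]
    · rw [h0, zero_mul]
  rcases lt_or_gt_of_ne h1 with h1 | h1
  · simpa using key (fun z => -g z) (by simp [h0]) (by rw [deriv.fun_neg]; linarith)
  · exact key g h0 h1

section expSum

variable {ι : Type*} [Fintype ι] (a : ι → ℝ)

theorem hasDerivAt_expSum (c : ι → ℝ) (s : ℝ) :
    HasDerivAt (expSum a c) (expSum a (fun i => c i * a i) s) s := by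
  have : ∀ i ∈ Finset.univ, HasDerivAt (fun s => c i * Real.exp (a i * s))
      (c i * a i * Real.exp (a i * s)) s := fun i _ => by
    have h := (((hasDerivAt_id s).const_mul (a i)).exp).const_mul (c i)
    simp only [id_eq, mul_one] at h
    rw [mul_assoc, mul_comm (a i)]
    exact h
  exact HasDerivAt.fun_sum this

theorem continuous_expSum_uncurry : Continuous fun p : (ι → ℝ) × ℝ => expSum a p.1 p.2 := by
  unfold expSum
  fun_prop

theorem continuous_deriv_expSum_uncurry :
    Continuous fun p : (ι → ℝ) × ℝ => deriv (expSum a p.1) p.2 := by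
  simp_rw [fun c s => (hasDerivAt_expSum a c s).deriv]
  unfold expSum
  fun_prop

/-- Nondegenerate zeros persist under small perturbations of the coefficients. -/
theorem eventually_exists_nondegZeros {c : ι → ℝ} {s : ℝ} (hs : s ∈ nondegZeros (expSum a c))
    {U : Set ℝ} (hU : U ∈ 𝓝 s) :
    ∀ᶠ c' in 𝓝 c, ∃ y ∈ U, y ∈ nondegZeros (expSum a c') := by
  have hd : ∀ᶠ p in 𝓝 c ×ˢ 𝓝 s, deriv (expSum a p.1) p.2 ≠ 0 := by
    rw [← nhds_prod_eq]
    exact (continuous_deriv_expSum_uncurry a).continuousAt.eventually_ne hs.2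
  obtain ⟨V, hV, W, hW, hVW⟩ := eventually_prod_iff.1 hd
  obtain ⟨Q, hQ, hsign⟩ := exists_nhds_mul_nonpos hs
  obtain ⟨l, r, hs', hlr⟩ := mem_nhds_iff_exists_Ioo_subset.1 (inter_mem (inter_mem hU hW) hQ)
  obtain ⟨x, hlx, hxs⟩ := exists_between hs'.1
  obtain ⟨y, hsy, hyr⟩ := exists_between hs'.2
  have hneg := (hsign x (hlr ⟨hlx, hxs.trans hs'.2⟩).2 y (hlr ⟨hs'.1.trans hsy, hyr⟩).2
    hxs.le hsy.le).2 hxs hsy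
  have hcont : Continuous fun c' : ι → ℝ => expSum a c' x * expSum a c' y := by
    unfold expSum
    fun_prop
  filter_upwards [hcont.continuousAt.eventually_lt_const hneg, hV] with c' h1 h2
  have hg : Continuous (expSum a c') :=
    (continuous_expSum_uncurry a).comp (continuous_const.prodMk continuous_id)
  have hxy : x ≤ y := (hxs.trans hsy).le
  have hz : (0 : ℝ) ∈ expSum a c' '' Icc x y := by
    rcases mul_neg_iff.1 h1 with h | h
    · exact intermediate_value_Icc' hxy hg.continuousOn ⟨h.2.le, h.1.le⟩
    · exact intermediate_value_Icc hxy hg.continuousOn ⟨h.1.le, h.2.le⟩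
  obtain ⟨z, hz, hz0⟩ := hz
  have hzI := (hlr ⟨hlx.trans_le hz.1, hz.2.trans_lt hyr⟩).1
  exact ⟨z, hzI.1, hz0, hVW h2 hzI.2⟩

/-- To bound an extended cardinality from below it suffices to bound its finite parts. -/
theorem exists_finset_of_lt_encard {S : Set ℝ} {b : ℝ≥0∞} (hb : b < (S.encard : ℝ≥0∞)) :
    ∃ T : Finset ℝ, (T : Set ℝ) ⊆ S ∧ b < T.card := by
  obtain ⟨m, hbm, hm⟩ : ∃ m : ℕ, b < m ∧ (m : ℕ∞) ≤ S.encard := by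
    rcases eq_or_ne S.encard ⊤ with h | h
    · rw [h, ENat.toENNReal_top] at hb
      obtain ⟨m, hm⟩ := ENNReal.exists_nat_gt hb.ne
      exact ⟨m, hm, by simp [h]⟩
    · obtain ⟨m, hm⟩ := ENat.ne_top_iff_exists.1 h
      rw [← hm] at hb ⊢
      exact ⟨m, by simpa using hb, le_rfl⟩
  obtain ⟨T, hT, hTm⟩ := exists_subset_encard_eq hm
  have hfin : T.Finite := finite_of_encard_eq_coe hTm
  refine ⟨hfin.toFinset, by simpa using hT, ?_⟩
  rw [hfin.encard_eq_coe_toFinset_card] at hTm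
  rwa [Nat.cast_inj.1 hTm]

/-- The number of nondegenerate zeros is a Borel function of the coefficients because it is lower
semicontinuous. -/
theorem lowerSemicontinuous_encard_nondegZeros :
    LowerSemicontinuous fun c : ι → ℝ => ((nondegZeros (expSum a c)).encard : ℝ≥0∞) := by
  intro c b hb
  obtain ⟨T, hT, hbT⟩ := exists_finset_of_lt_encard hb
  obtain ⟨U, hU, hdisj⟩ := T.finite_toSet.t2_separation
  have hev : ∀ᶠ c' in 𝓝 c, ∀ s ∈ T, ∃ y ∈ U s, y ∈ nondegZeros (expSum a c') :=
    (eventually_all_finset T).2 fun s hs =>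
      eventually_exists_nondegZeros a (hT hs) ((hU s).2.mem_nhds (hU s).1)
  filter_upwards [hev] with c' hc'
  choose! y hyU hy using hc'
  refine hbT.trans_le ?_
  have hinj : InjOn y T := fun s hs s' hs' hss => by
    by_contra hne
    exact (Set.disjoint_left.1 (hdisj hs hs' hne)) (hyU s hs) (hss ▸ hyU s' hs')
  have h1 : (y '' T).encard ≤ (nondegZeros (expSum a c')).encard :=
    encard_le_encard (image_subset_iff.2 fun s hs => hy s hs)
  rw [hinj.encard_image, encard_coe_eq_coe_finsetCard] at h1
  simpa using ENat.toENNReal_le.2 h1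

end expSum

/-! ### Counting zeros by sign changes on a grid -/

/-- The points of mesh `1 / n` starting at `-n`. -/
noncomputable def grid (n k : ℕ) : ℝ := -n + k / n

/-- The number of steps of the grid of mesh `1 / n` on `[-n, n]` over which `g` does not keep a
strict sign. -/
noncomputable def signChanges (g : ℝ → ℝ) (n : ℕ) : ℕ :=
  Finset.card {k ∈ Finset.range (2 * n * n) | g (grid n k) * g (grid n (k + 1)) ≤ 0}

theorem grid_monotone (n : ℕ) : Monotone (grid n) := by
  intro j k hjk
  have : (j : ℝ) ≤ k := by exact_mod_cast hjk
  unfold grid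
  gcongr

theorem grid_succ_sub (n k : ℕ) : grid n (k + 1) - grid n k = 1 / n := by
  unfold grid
  push_cast
  ring

theorem grid_floor {n : ℕ} (hn : 0 < n) {s : ℝ} (hs : -(n : ℝ) ≤ s) :
    grid n ⌊(s + n) * n⌋₊ ≤ s ∧ s < grid n (⌊(s + n) * n⌋₊ + 1) := by
  have hn' : (0 : ℝ) < n := by exact_mod_cast hn
  have h0 : 0 ≤ (s + n) * n := mul_nonneg (by linarith) hn'.le
  have h1 := Nat.floor_le h0
  have h2 := Nat.lt_floor_add_one ((s + n) * n)
  unfold grid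
  constructor
  · have := (div_le_iff₀ hn').2 h1
    linarith
  · push_cast
    have := (lt_div_iff₀ hn').2 h2
    linarith

/-- On a fine grid distinct zeros lie in distinct steps, and a step containing a nondegenerate zero
shows a sign change. Counting products `≤ 0` makes this hold also when zeros lie on the grid. -/
theorem encard_nondegZeros_le_liminf (g : ℝ → ℝ) :
    ((nondegZeros g).encard : ℝ≥0∞) ≤ liminf (fun n => (signChanges g n : ℝ≥0∞)) atTop := by
  refine le_of_forall_lt fun b hb => ?_
  obtain ⟨T, hT, hbT⟩ := exists_finset_of_lt_encard hb
  refine hbT.trans_le ?_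
  have hinv : Tendsto (fun n : ℕ => (1 : ℝ) / n) atTop (𝓝 0) := tendsto_one_div_atTop_nhds_zero_nat
  have hnat : Tendsto (fun n : ℕ => (n : ℝ)) atTop atTop := tendsto_natCast_atTop_atTop
  -- every zero in `T` lies in a step of the grid with a sign change
  have hA : ∀ s ∈ T, ∀ᶠ n : ℕ in atTop, ⌊(s + n) * n⌋₊ ∈ {k ∈ Finset.range (2 * n * n) |
      g (grid n k) * g (grid n (k + 1)) ≤ 0} := by
    intro s hs
    obtain ⟨V, hV, hsign⟩ := exists_nhds_mul_nonpos (hT hs)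
    obtain ⟨ε, hε, hball⟩ := Metric.mem_nhds_iff.1 hV
    filter_upwards [hinv.eventually_lt_const hε, eventually_gt_atTop 0,
      hnat.eventually_gt_atTop (-s), hnat.eventually_gt_atTop s] with n hn hn0 h1 h2
    have hn' : (0 : ℝ) < n := by exact_mod_cast hn0
    have g1 := grid_floor hn0 (s := s) (by linarith)
    have g2 := grid_succ_sub n ⌊(s + n) * n⌋₊
    rw [Finset.mem_filter, Finset.mem_range]
    constructor
    · rw [Nat.floor_lt (mul_nonneg (by linarith) hn'.le)]
      push_cast
      exact mul_lt_mul_of_pos_right (by linarith) hn'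
    · refine (hsign _ (hball ?_) _ (hball ?_) g1.1 g1.2.le).1
      · rw [Metric.mem_ball, Real.dist_eq, abs_lt]
        constructor <;> linarith
      · rw [Metric.mem_ball, Real.dist_eq, abs_lt]
        constructor <;> linarith
  have hB : ∀ s ∈ T, ∀ s' ∈ T, s ≠ s' → ∀ᶠ n : ℕ in atTop,
      ⌊(s + n) * n⌋₊ ≠ ⌊(s' + n) * n⌋₊ := by
    intro s _ s' _ hne
    have hpos : 0 < |s - s'| := abs_pos.2 (sub_ne_zero.2 hne)
    filter_upwards [hinv.eventually_lt_const hpos, eventually_gt_atTop 0,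
      hnat.eventually_ge_atTop (-s), hnat.eventually_ge_atTop (-s')] with n hn hn0 h1 h2 heq
    have g1 := grid_floor hn0 (s := s) (by linarith)
    have g2 := grid_floor hn0 (s := s') (by linarith)
    rw [← heq] at g2
    have := grid_succ_sub n ⌊(s + n) * n⌋₊
    rcases abs_cases (s - s') with h | h <;> linarith
  have hev : ∀ᶠ n : ℕ in atTop, T.card ≤ signChanges g n := by
    have hB' := (eventually_all_finset T).2 fun s hs => (eventually_all_finset T).2 fun s' hs' =>
      (eventually_imp_distrib_left (p := s ≠ s')).2 (hB s hs s' hs')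
    filter_upwards [(eventually_all_finset T).2 hA, hB'] with n h1 h2
    refine Finset.card_le_card_of_injOn (fun s => ⌊(s + n) * n⌋₊) h1 fun s hs s' hs' h => ?_
    by_contra hne
    exact h2 s hs s' hs' hne h
  exact le_liminf_of_le (by isBoundedDefault) (hev.mono fun n hn => by exact_mod_cast hn)

end Zeros

/-! ### The expected number of zeros of a Gaussian exponential sum -/

section Expectation

open MeasureTheory ProbabilityTheory Real Filter Topology

variable {Ω : Type*} [MeasurableSpace Ω] {P : Measure Ω}

theorem aemeasurable_expSum {ι : Type*} [Fintype ι] {ξ : ι → Ω → ℝ}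
    (hξ : ∀ i, AEMeasurable (ξ i) P) (a : ι → ℝ) (s : ℝ) :
    AEMeasurable (fun ω => expSum a (fun i => ξ i ω) s) P := by
  unfold expSum
  fun_prop

theorem nullMeasurableSet_sign_change {ι : Type*} [Fintype ι] {ξ : ι → Ω → ℝ}
    (hξ : ∀ i, AEMeasurable (ξ i) P) (a : ι → ℝ) (s s' : ℝ) :
    NullMeasurableSet {ω | expSum a (fun i => ξ i ω) s * expSum a (fun i => ξ i ω) s' ≤ 0} P :=
  nullMeasurableSet_le ((aemeasurable_expSum hξ a s).mul (aemeasurable_expSum hξ a s'))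
    aemeasurable_const

theorem signChanges_eq_sum_indicator {ι α : Type*} [Fintype ι] (ξ : ι → α → ℝ) (a : ι → ℝ)
    (n : ℕ) (ω : α) :
    (signChanges (expSum a (fun i => ξ i ω)) n : ℝ≥0∞)
      = ∑ k ∈ Finset.range (2 * n * n),
        {ω | expSum a (fun i => ξ i ω) (grid n k) * expSum a (fun i => ξ i ω) (grid n (k + 1)) ≤ 0
          }.indicator 1 ω := by
  classical
  rw [signChanges, Finset.card_filter, Nat.cast_sum]
  refine Finset.sum_congr rfl fun k _ => ?_
  simp [Set.indicator_apply]

variable [IsProbabilityMeasure P]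

/-- A sign change between `s` and `s'` is as likely as the angle between the two points of the unit
curve is large, and for `s'` near `s` this angle is almost bounded by their `ℓ¹` distance. -/
theorem measure_expSum_sign_change_le {ι : Type*} [Fintype ι] [Nonempty ι] {ξ : ι → Ω → ℝ}
    (hlaw : ∀ i, HasLaw (ξ i) (gaussianReal 0 1) P) (hindep : iIndepFun ξ P) (a : ι → ℝ) {D : ℝ}
    (hD : ∀ i, |a i| ≤ D) {s s' : ℝ} (hs : s ≤ s') :
    P {ω | expSum a (fun i => ξ i ω) s * expSum a (fun i => ξ i ω) s' ≤ 0}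
      ≤ ENNReal.ofReal
        (exp (2 * D * (s' - s)) / π * ∑ i, |unitCurve a s' i - unitCurve a s i|) := by
  set ρ := ∑ i, unitCurve a s i * unitCurve a s' i with hρ
  have hρ0 : exp (-(2 * D * (s' - s))) ≤ ρ := exp_le_inner_unitCurve a hD hs
  have hρpos : 0 < ρ := (exp_pos _).trans_le hρ0
  have hu := sum_unitCurve_sq a s
  have hw := sum_unitCurve_sq a s'
  have hset : {ω | expSum a (fun i => ξ i ω) s * expSum a (fun i => ξ i ω) s' ≤ 0}
      = {ω | (∑ i, unitCurve a s i * ξ i ω) * (∑ i, unitCurve a s' i * ξ i ω) ≤ 0} := by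
    ext ω
    simp only [Set.mem_ofPred_eq]
    rw [expSum_eq_norm_mul, expSum_eq_norm_mul, mul_mul_mul_comm]
    simpa using mul_le_mul_iff_of_pos_left (c := 0)
      (b := (∑ i, unitCurve a s i * ξ i ω) * ∑ i, unitCurve a s' i * ξ i ω)
      (mul_pos (sqrt_sum_exp_pos a s) (sqrt_sum_exp_pos a s'))
  rw [hset]
  refine (sign_change_linear_forms_le hlaw hindep _ _ hu hw hρpos.le).trans
    (ENNReal.ofReal_le_ofReal ?_)
  rw [div_mul_eq_mul_div]
  refine div_le_div_of_nonneg_right ?_ pi_pos.le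
  have h1 := arccos_mul_le_sum_abs_sub _ _ hu hw hρpos
  have h2 : arccos ρ * exp (-(2 * D * (s' - s))) ≤ ∑ i, |unitCurve a s' i - unitCurve a s i| :=
    (mul_le_mul_of_nonneg_left hρ0 (arccos_nonneg _)).trans h1
  rw [Real.exp_neg, ← div_eq_mul_inv, div_le_iff₀ (exp_pos _)] at h2
  linarith

theorem lintegral_signChanges_le {t : ℕ} (ht : 3 ≤ t) {ξ : Fin t → Ω → ℝ}
    (hlaw : ∀ i, HasLaw (ξ i) (gaussianReal 0 1) P) (hindep : iIndepFun ξ P) {a : Fin t → ℝ}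
    (ha : Monotone a) {D : ℝ} (hD : ∀ i, |a i| ≤ D) (n : ℕ) :
    ∫⁻ ω, (signChanges (expSum a (fun i => ξ i ω)) n : ℝ≥0∞) ∂P
      ≤ ENNReal.ofReal (exp (2 * D * (1 / n)) / π * (2 * √(t : ℝ) * log t)) := by
  have : Nonempty (Fin t) := ⟨⟨0, by omega⟩⟩
  have hmeas := nullMeasurableSet_sign_change (fun i => (hlaw i).aemeasurable) a
  simp_rw [signChanges_eq_sum_indicator]
  have hind : ∀ s s', AEMeasurable ({ω | expSum a (fun i => ξ i ω) s *
      expSum a (fun i => ξ i ω) s' ≤ 0}.indicator (1 : Ω → ℝ≥0∞)) P := fun s s' =>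
    aemeasurable_one.indicator₀ (hmeas s s')
  rw [lintegral_finsetSum' _ fun k _ => hind (grid n k) (grid n (k + 1))]
  simp_rw [lintegral_indicator_one₀ (hmeas _ _)]
  calc _ ≤ ∑ k ∈ Finset.range (2 * n * n), ENNReal.ofReal (exp (2 * D * (1 / n)) / π *
        ∑ i, |unitCurve a (grid n (k + 1)) i - unitCurve a (grid n k) i|) := by
        refine Finset.sum_le_sum fun k _ => ?_
        have := measure_expSum_sign_change_le hlaw hindep a hD (grid_monotone n k.le_succ)
        rwa [grid_succ_sub] at this
    _ = ENNReal.ofReal (exp (2 * D * (1 / n)) / π * ∑ k ∈ Finset.range (2 * n * n),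
        ∑ i, |unitCurve a (grid n (k + 1)) i - unitCurve a (grid n k) i|) := by
        rw [← ENNReal.ofReal_sum_of_nonneg fun k _ => by positivity, Finset.mul_sum]
    _ ≤ _ := by
        refine ENNReal.ofReal_le_ofReal (mul_le_mul_of_nonneg_left ?_ (by positivity))
        exact sum_variation_unitCurve_le ht a ha _ (grid_monotone n) _

theorem lintegral_encard_nondegZeros_le_of_three_le {t : ℕ} (ht : 3 ≤ t) {ξ : Fin t → Ω → ℝ}
    (hlaw : ∀ i, HasLaw (ξ i) (gaussianReal 0 1) P) (hindep : iIndepFun ξ P) {a : Fin t → ℝ}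
    (ha : Monotone a) :
    ∫⁻ ω, ((nondegZeros (expSum a (fun i => ξ i ω))).encard : ℝ≥0∞) ∂P
      ≤ ENNReal.ofReal (2 / π * √(t : ℝ) * log t) := by
  have hD : ∀ i, |a i| ≤ ∑ k, |a k| := fun i =>
    Finset.single_le_sum (f := fun k => |a k|) (fun k _ => abs_nonneg _) (Finset.mem_univ i)
  set D := ∑ k, |a k|
  have hmeas : ∀ n, AEMeasurable
      (fun ω => (signChanges (expSum a (fun i => ξ i ω)) n : ℝ≥0∞)) P := fun n => by
    simp_rw [signChanges_eq_sum_indicator]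
    exact Finset.aemeasurable_fun_sum _ fun k _ => (aemeasurable_const (b := 1)).indicator₀
      (nullMeasurableSet_sign_change (fun i => (hlaw i).aemeasurable) a _ _)
  have hlim : Tendsto (fun n : ℕ =>
      ENNReal.ofReal (exp (2 * D * (1 / n)) / π * (2 * √(t : ℝ) * log t))) atTop
      (𝓝 (ENNReal.ofReal (2 / π * √(t : ℝ) * log t))) := by
    apply ENNReal.tendsto_ofReal
    have h0 : Tendsto (fun n : ℕ => 2 * D * ((1 : ℝ) / n)) atTop (𝓝 (2 * D * 0)) :=
      tendsto_one_div_atTop_nhds_zero_nat.const_mul _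
    have h := (((Real.continuous_exp.tendsto _).comp h0).div_const π).mul_const
      (2 * √(t : ℝ) * log t)
    rw [mul_zero, Real.exp_zero] at h
    have e : 2 / π * √(t : ℝ) * log t = 1 / π * (2 * √(t : ℝ) * log t) := by ring
    rw [e]
    exact h
  calc _ ≤ ∫⁻ ω, liminf (fun n => (signChanges (expSum a (fun i => ξ i ω)) n : ℝ≥0∞)) atTop ∂P :=
        lintegral_mono fun ω => encard_nondegZeros_le_liminf _
    _ ≤ liminf (fun n => ∫⁻ ω, (signChanges (expSum a (fun i => ξ i ω)) n : ℝ≥0∞) ∂P) atTop :=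
        lintegral_liminf_le' hmeas
    _ ≤ liminf (fun n : ℕ =>
        ENNReal.ofReal (exp (2 * D * (1 / n)) / π * (2 * √(t : ℝ) * log t))) atTop :=
        liminf_le_liminf (Eventually.of_forall (lintegral_signChanges_le ht hlaw hindep ha hD))
    _ = _ := hlim.liminf_eq

/-- A single exponential with a zero vanishes identically, so its zeros are degenerate. -/
theorem nondegZeros_expSum_eq_empty {ι : Type*} [Fintype ι] [Subsingleton ι] (a c : ι → ℝ) :
    nondegZeros (expSum a c) = ∅ := by
  refine Set.eq_empty_of_forall_notMem fun s hs => hs.2 ?_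
  have h := hs.1
  rw [(hasDerivAt_expSum a c s).deriv]
  refine Finset.sum_eq_zero fun i _ => ?_
  rw [expSum, Finset.sum_eq_single i (fun j _ hji => absurd (Subsingleton.elim j i) hji)
    (by simp)] at h
  have hc : c i = 0 := (mul_eq_zero_iff_right (exp_pos _).ne').1 h
  simp [hc]

/-- A binomial has at most one nondegenerate zero, and none if its coefficients have the same
strict sign. -/
theorem encard_nondegZeros_binomial_le {a : Fin 2 → ℝ} (ha : a 0 ≠ a 1) (c : Fin 2 → ℝ) :
    ((nondegZeros (expSum a c)).encard : ℝ≥0∞)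
      ≤ {c : Fin 2 → ℝ | c 0 * c 1 ≤ 0}.indicator 1 c := by
  have hzero : ∀ s ∈ nondegZeros (expSum a c), c 1 ≠ 0 ∧ c 0 = -c 1 * exp ((a 1 - a 0) * s) := by
    rintro s ⟨h0, h1⟩
    rw [(hasDerivAt_expSum a c s).deriv] at h1
    simp only [expSum, Fin.sum_univ_two] at h0 h1
    have hE := exp_pos (a 0 * s)
    have he : exp (a 1 * s) = exp (a 0 * s) * exp ((a 1 - a 0) * s) := by
      rw [← Real.exp_add]; congr 1; ring
    have hc : c 0 = -c 1 * exp ((a 1 - a 0) * s) := by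
      rw [he] at h0
      apply mul_right_cancel₀ hE.ne'
      linear_combination h0
    refine ⟨fun h => h1 ?_, hc⟩
    rw [h] at hc
    simp [h, hc]
  by_cases hmem : c ∈ {c : Fin 2 → ℝ | c 0 * c 1 ≤ 0}
  · rw [Set.indicator_of_mem hmem, Pi.one_apply]
    have : (nondegZeros (expSum a c)).encard ≤ 1 := by
      rw [Set.encard_le_one_iff]
      intro s s' hs hs'
      obtain ⟨h0, h1⟩ := hzero s hs
      obtain ⟨-, h2⟩ := hzero s' hs'
      have h3 := mul_left_cancel₀ (neg_ne_zero.2 h0) (h1.symm.trans h2)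
      exact mul_left_cancel₀ (sub_ne_zero.2 ha.symm) (Real.exp_injective h3)
    simpa using ENat.toENNReal_le.2 this
  · have : nondegZeros (expSum a c) = ∅ := by
      refine Set.eq_empty_of_forall_notMem fun s hs => hmem ?_
      obtain ⟨-, h1⟩ := hzero s hs
      change c 0 * c 1 ≤ 0
      have hE := exp_pos ((a 1 - a 0) * s)
      rw [h1]
      nlinarith [mul_nonneg hE.le (mul_self_nonneg (c 1))]
    simp [this]

theorem lintegral_encard_nondegZeros_binomial_le {ξ : Fin 2 → Ω → ℝ}
    (hlaw : ∀ i, HasLaw (ξ i) (gaussianReal 0 1) P) (hindep : iIndepFun ξ P) {a : Fin 2 → ℝ}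
    (ha : a 0 ≠ a 1) :
    ∫⁻ ω, ((nondegZeros (expSum a (fun i => ξ i ω))).encard : ℝ≥0∞) ∂P ≤ ENNReal.ofReal (1 / 2) := by
  have hmeas : NullMeasurableSet {ω | ξ 0 ω * ξ 1 ω ≤ 0} P :=
    nullMeasurableSet_le ((hlaw 0).aemeasurable.mul (hlaw 1).aemeasurable) aemeasurable_const
  calc _ ≤ ∫⁻ ω, {ω | ξ 0 ω * ξ 1 ω ≤ 0}.indicator 1 ω ∂P :=
        lintegral_mono fun ω => encard_nondegZeros_binomial_le ha _
    _ = P {ω | ξ 0 ω * ξ 1 ω ≤ 0} := lintegral_indicator_one₀ hmeas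
    _ ≤ _ := by
        have h := sign_change_linear_forms_le hlaw hindep ![1, 0] ![0, 1] (by simp) (by simp)
          (by simp)
        have e : π / 2 / π = 1 / 2 := by field_simp
        simpa [Fin.sum_univ_two, e] using h

theorem lintegral_encard_nondegZeros_le {t : ℕ} {ξ : Fin t → Ω → ℝ}
    (hlaw : ∀ i, HasLaw (ξ i) (gaussianReal 0 1) P) (hindep : iIndepFun ξ P) {a : Fin t → ℝ}
    (ha : StrictMono a) :
    ∫⁻ ω, ((nondegZeros (expSum a (fun i => ξ i ω))).encard : ℝ≥0∞) ∂P
      ≤ ENNReal.ofReal (2 / π * √(t : ℝ) * log t) := by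
  rcases lt_or_ge t 2 with ht | ht
  · have : Subsingleton (Fin t) := Fin.subsingleton_iff_le_one.2 (by omega)
    simp [nondegZeros_expSum_eq_empty]
  rcases ht.eq_or_lt with rfl | ht
  · refine (lintegral_encard_nondegZeros_binomial_le hlaw hindep
      (ha (show (0 : Fin 2) < 1 by decide)).ne).trans (ENNReal.ofReal_le_ofReal ?_)
    have h2 : (1.41 : ℝ) ≤ √2 := Real.le_sqrt_of_sq_le (by norm_num)
    have hl := Real.log_two_gt_d9
    have hpi := Real.pi_lt_d2
    rw [div_mul_eq_mul_div, div_mul_eq_mul_div, div_le_div_iff₀ (by norm_num) pi_pos]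
    push_cast
    nlinarith
  · exact lintegral_encard_nondegZeros_le_of_three_le ht hlaw hindep ha.monotone

end Expectation

/-! ### From exponential sums to sparse polynomials -/

theorem eval_exp {t : ℕ} (A : Finset ℤ) (e : Fin t ≃ A) (c : A → ℝ) (s : ℝ) :
    eval A (fun _ => 1) c (Real.exp s)
      = expSum (fun i => (((e i : A) : ℤ) : ℝ)) (fun i => c (e i)) s := by
  rw [eval, expSum, ← e.sum_comp]
  refine Finset.sum_congr rfl fun i _ => ?_
  rw [one_mul, mul_comm (_ : ℝ) s, Real.exp_mul, Real.rpow_intCast]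

theorem differentiableAt_eval (A : Finset ℤ) (σ c : A → ℝ) {x : ℝ} (hx : x ≠ 0) :
    DifferentiableAt ℝ (eval A σ c) x :=
  DifferentiableAt.fun_sum fun _ _ =>
    (differentiableAt_zpow.2 (Or.inl hx)).const_mul _

/-- Under `x = exp s` the nondegenerate positive zeros of a sparse polynomial correspond to the
nondegenerate real zeros of an exponential sum. -/
theorem nondegPosZeros_eval {t : ℕ} (A : Finset ℤ) (e : Fin t ≃ A) (c : A → ℝ) :
    nondegPosZeros (eval A (fun _ => 1) c) = Real.exp ''
      nondegZeros (expSum (fun i => (((e i : A) : ℤ) : ℝ)) (fun i => c (e i))) := by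
  have hderiv : ∀ s, deriv (expSum (fun i => (((e i : A) : ℤ) : ℝ)) (fun i => c (e i))) s
      = deriv (eval A (fun _ => 1) c) (Real.exp s) * Real.exp s := by
    intro s
    rw [← funext (eval_exp A e c)]
    exact ((differentiableAt_eval A _ c (Real.exp_pos s).ne').hasDerivAt.comp s
      (Real.hasDerivAt_exp s)).deriv
  ext x
  constructor
  · rintro ⟨hx, h0, h1⟩
    refine ⟨Real.log x, ⟨?_, ?_⟩, Real.exp_log hx⟩
    · rw [← eval_exp, Real.exp_log hx, h0]
    · rw [hderiv, Real.exp_log hx]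
      exact mul_ne_zero h1 hx.ne'
  · rintro ⟨s, ⟨h0, h1⟩, rfl⟩
    rw [hderiv] at h1
    exact ⟨Real.exp_pos s, by rw [eval_exp A e, h0], left_ne_zero_of_mul h1⟩

theorem numZeros_eq {t : ℕ} (A : Finset ℤ) (e : Fin t ≃ A) (c : A → ℝ) :
    numZeros A (fun _ => 1) c = ((nondegZeros
      (expSum (fun i => (((e i : A) : ℤ) : ℝ)) (fun i => c (e i)))).encard : ℝ≥0∞) := by
  rw [numZeros, nondegPosZeros_eval A e, Real.exp_injective.encard_image]

end SparsePoly

theorem theorem1p5 {Ω : Type*} [MeasurableSpace Ω] (P : MeasureTheory.Measure Ω)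
    [MeasureTheory.IsProbabilityMeasure P] (A : Finset ℤ) (t : ℕ) (ht : A.card = t)
    (ξ : A → Ω → ℝ)
    (hlaw : ∀ α, ProbabilityTheory.HasLaw (ξ α) (ProbabilityTheory.gaussianReal 0 1) P)
    (hindep : ProbabilityTheory.iIndepFun ξ P) :
    AEMeasurable (fun ω => SparsePoly.numZeros A (fun _ => 1) (fun α => ξ α ω)) P ∧
      ∫⁻ ω, SparsePoly.numZeros A (fun _ => 1) (fun α => ξ α ω) ∂P ≤
        ENNReal.ofReal (2 / Real.pi * Real.sqrt (t : ℝ) * Real.log (t : ℝ)) := by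
  set e := A.orderIsoOfFin ht
  have ha : StrictMono fun i => (((e i : A) : ℤ) : ℝ) := fun i j hij => by
    exact Int.cast_lt.2 (e.strictMono hij)
  simp_rw [fun ω => SparsePoly.numZeros_eq A e.toEquiv fun α => ξ α ω]
  constructor
  · exact (SparsePoly.lowerSemicontinuous_encard_nondegZeros _).measurable.comp_aemeasurable
      (aemeasurable_pi_lambda _ fun i => (hlaw _).aemeasurable)
  · exact SparsePoly.lintegral_encard_nondegZeros_le (fun i => hlaw _)
      (hindep.precomp e.injective) ha
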